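/- Let $x_1,\dots,x_n\in\mathbb R^D$ be fixed vectors, let $\lambda_0\in\mathbb R^D$, and let $$Y_j=\lambda_0^Tx_j+\xi_j,\qquad 1\le j\le n,$$ where $\xi_1,\dots,\xi_n$ are independent zero-mean random variables with $\mathrm{Var}(\xi_j)\le\sigma^2<\infty$, $\sigma\ge 0$. Write $\|\cdot\|$, $\|\cdot\|_1$ and $\|\cdot\|_\infty$ for the Euclidean, $\ell_1$ and sup-norm, and $N(\lambda_0)=|\{i:\lambda_{0,i}\neq 0\}|$. For $u\in\mathbb R^D$ and $J\subseteq\{1,\dots,D\}$ let $u_J\in\mathbb R^D$ be the vector that agrees with $u$ on $J$ and vanishes on the complement $J^c$. Let $t>0$, $k=\lfloor 3.5\,t\rfloor+1$, and assume $k\le n/2$. Let $m=\lfloor n/k\rfloor$ and, for $1\le l\le k$, let $G_l=\{(l-1)m+1,\dots,lm\}$, let $\mathbb X_l$ be the $m\times D$ matrix with rows $x_j^T$, $j\in G_l$, and for $c_0>0$ and an integer $s\ge 0$ let $$\kappa_l(s,c_0)=\min_{\substack{J\subseteq\{1,\dots,D\}\\|J|\le s}}\ \min_{\substack{u\in\mathbb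 R^D,\ u\ne0\\ \|u_{J^c}\|_1\le c_0\|u_J\|_1}}\frac{\|\mathbb X_lu\|}{\sqrt m\,\|u_J\|}$$ (with $\kappa_l(s,c_0)=+\infty$ if there is no such pair $(J,u)$, as for $s=0$). Assume that $\|x_j\|_\infty\le M$ for $1\le j\le n$ and that $$\bar\kappa:=\min_{1\le l\le k}\kappa_l(2N(\lambda_0),3)>0.$$ Let $\varepsilon>0$ satisfy $$\varepsilon\ \ge\ 95\,M\sigma\sqrt{\frac{t+2/7}{n}\,\log(2D)} .$$ For $1\le l\le k$ let $\hat\lambda^l_\varepsilon$ be a Lasso estimator computed on the $l$-th block, that is, any minimizer over $\lambda\in\mathbb R^D$ of $$\frac1{|G_l|}\sum_{j\in G_l}\left(Y_j-\lambda^Tx_j\right)^2+\varepsilon\|\lambda\|_1,$$ and let $\hat\lambda^*_\varepsilon$ be a geometric median of these estimators, that is, any minimizer over $y\in\mathbb R^D$ of $\sum_{l=1}^k\|y-\hat\lambda^l_\varepsilon\|$. Then, with probability at least $1-e^{-t}$, $$\left\|\hat\lambda^*_\varepsilon-\lambda_0\right\|^2\ \le\ 83\,\varepsilon^2\,\frac{N(\lambda_0)}{\bar\kappa^4}$$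 (where the right-hand side is $0$ if $\lambda_0=0$). -/

import Mathlib

open MeasureTheory ProbabilityTheory
open scoped ENNReal

namespace RobustLasso

/-- The number `N(v)` of nonzero coordinates of `v`. -/
noncomputable def supportSize {D : ℕ} (v : EuclideanSpace ℝ (Fin D)) : ℕ :=
  (Finset.univ.filter (fun i => v i ≠ 0)).card

/-- The `ℓ₁` norm on `ℝ^D`. -/
noncomputable def l1Norm {D : ℕ} (v : EuclideanSpace ℝ (Fin D)) : ℝ :=
  ∑ i, |v i|

/-- The vector `u_J`: it agrees with `u` on `J` and vanishes off `J`. -/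
noncomputable def coordRestrict {D : ℕ} (J : Finset (Fin D)) (u : EuclideanSpace ℝ (Fin D)) :
    EuclideanSpace ℝ (Fin D) :=
  WithLp.toLp 2 (fun i => if i ∈ J then u i else 0)

/-- The restricted eigenvalue `κ(s, c₀)` of the design matrix whose rows are the vectors `x j`,
`j ∈ G`: the minimum of `‖X u‖ / (√|G| ‖u_J‖)` over the sets `J` with `|J| ≤ s` and the nonzero
vectors `u` in the cone `‖u_{Jᶜ}‖₁ ≤ c₀ ‖u_J‖₁` (on which `u_J ≠ 0`).
It is `∞` if there is no such pair `(J, u)`, as is the case for `s = 0`. -/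
noncomputable def restrictedEigenvalue {n D : ℕ} (x : Fin n → EuclideanSpace ℝ (Fin D))
    (G : Finset (Fin n)) (s : ℕ) (c₀ : ℝ) : ℝ≥0∞ :=
  ⨅ (J : Finset (Fin D)) (_ : J.card ≤ s) (u : EuclideanSpace ℝ (Fin D)) (_ : u ≠ 0)
    (_ : l1Norm (coordRestrict Jᶜ u) ≤ c₀ * l1Norm (coordRestrict J u)),
    ENNReal.ofReal (√(∑ j ∈ G, (inner ℝ u (x j)) ^ 2) / (√(G.card : ℝ) * ‖coordRestrict J u‖))

/-- The Lasso objective for the data `(x j, y j)`, `j ∈ G`, with regularization parameter `ε`. -/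
noncomputable def lassoObjective {n D : ℕ} (x : Fin n → EuclideanSpace ℝ (Fin D)) (y : Fin n → ℝ)
    (G : Finset (Fin n)) (ε : ℝ) (v : EuclideanSpace ℝ (Fin D)) : ℝ :=
  1 / (G.card : ℝ) * ∑ j ∈ G, (y j - inner ℝ v (x j)) ^ 2 + ε * l1Norm v

/-- `v` is a Lasso estimator: a global minimizer of the Lasso objective over `ℝ^D`. -/
def IsLasso {n D : ℕ} (x : Fin n → EuclideanSpace ℝ (Fin D)) (y : Fin n → ℝ)
    (G : Finset (Fin n)) (ε : ℝ) (v : EuclideanSpace ℝ (Fin D)) : Prop :=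
  ∀ w, lassoObjective x y G ε v ≤ lassoObjective x y G ε w

/-- `z` is a geometric median of `p 1, …, p k`: a global minimizer of `y ↦ ∑ l, ‖y - p l‖`. -/
def IsGeometricMedian {E : Type*} [NormedAddCommGroup E] {k : ℕ} (p : Fin k → E) (z : E) : Prop :=
  ∀ y, ∑ l, ‖z - p l‖ ≤ ∑ l, ‖y - p l‖

/-- The `l`-th group of `m` consecutive indices, `{l m, …, (l + 1) m - 1}`, where indices and
groups are numbered from `0`. -/
def block (n m l : ℕ) : Finset (Fin n) :=
  Finset.univ.filter (fun j => l * m ≤ (j : ℕ) ∧ (j : ℕ) < (l + 1) * m)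

end RobustLasso

/-! Each block gives a Lasso estimate which is accurate with only moderate probability; the
geometric median boosts this to confidence `1 - exp (-t)`. Deterministically, if every coordinate of
the block noise `∑ ξ j * x j` is at most `ε * m / 4`, the basic inequality puts the Lasso error in
the restricted eigenvalue cone, and its squared norm is at most `45/2 * ε² * N / κ⁴`
(`IsLasso.norm_sub_sq_le`). Only second moments are available, so the noise is bounded in mean by a
log-sum-exp smoothing of the maximum, which costs a factor `log (2 D)`
(`integral_logSumExp_sum_le`). Markov's inequality then makes a block bad with probability at most
`0.137`. Blocks are disjoint, hence independent, so by Chernoff a fraction `0.46` of them is bad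
with probability at most `exp (-2k/7) ≤ exp (-t)` (`measureReal_card_gt_le`). Otherwise
`IsGeometricMedian.mul_norm_sub_sq_le` loses only the factor `0.54² / 0.08 = 3.645`, and `3.645 *
45/2 < 83`. -/

namespace RobustLasso

/-! ### Stability of the geometric median under a minority of bad points. -/

section GeometricMedian

variable {E : Type*} [NormedAddCommGroup E] [InnerProductSpace ℝ E]

/-- A quadratic upper bound for the norm along a line, away from the origin. -/
theorem norm_sub_smul_le {w : E} (hw : w ≠ 0) (v : E) (s : ℝ) :
    ‖w - s • v‖ ≤ ‖w‖ - s * (inner ℝ w v / ‖w‖) + s ^ 2 * (‖v‖ ^ 2 / (2 * ‖w‖)) := by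
  have hw' : 0 < ‖w‖ := norm_pos_iff.mpr hw
  have h1 : ‖w - s • v‖ ^ 2 = ‖w‖ ^ 2 - 2 * s * inner ℝ w v + s ^ 2 * ‖v‖ ^ 2 := by
    rw [norm_sub_sq_real, inner_smul_right, norm_smul, mul_pow, Real.norm_eq_abs, sq_abs]; ring
  -- The bound is the AM-GM majorant of `‖w - s • v‖`, tangent to it at `s = 0`.
  have h2 : ‖w‖ - s * (inner ℝ w v / ‖w‖) + s ^ 2 * (‖v‖ ^ 2 / (2 * ‖w‖)) =
      (‖w‖ ^ 2 + ‖w - s • v‖ ^ 2) / (2 * ‖w‖) := by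
    rw [h1]; field_simp; ring
  rw [h2, le_div_iff₀ (by positivity)]
  nlinarith [sq_nonneg (‖w‖ - ‖w - s • v‖)]

/-- A point of the ball of radius `r` about `v` is seen from the origin at an angle to `v` whose
sine is at most `r / ‖v‖`. -/
theorem sqrt_le_inner_div_norm {w v : E} (hw : w ≠ 0) {r : ℝ} (hr : ‖w - v‖ ≤ r)
    (hrv : r ≤ ‖v‖) : √(‖v‖ ^ 2 - r ^ 2) ≤ inner ℝ w v / ‖w‖ := by
  have hw' : 0 < ‖w‖ := norm_pos_iff.mpr hw
  have hr0 : 0 ≤ r := (norm_nonneg _).trans hr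
  have h1 := norm_sub_sq_real w v
  have h2 : ‖w - v‖ ^ 2 ≤ r ^ 2 := by gcongr
  have h3 : √(‖v‖ ^ 2 - r ^ 2) ^ 2 = ‖v‖ ^ 2 - r ^ 2 :=
    Real.sq_sqrt (by nlinarith)
  rw [le_div_iff₀ hw']
  nlinarith [sq_nonneg (‖w‖ - √(‖v‖ ^ 2 - r ^ 2))]

theorem nonneg_of_forall_mul_add_sq_nonneg {a c : ℝ} (hc : 0 ≤ c)
    (h : ∀ s : ℝ, 0 < s → 0 ≤ s * a + s ^ 2 * c) : 0 ≤ a := by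
  by_contra! ha
  have h1 := h (-a / (c + 1)) (div_pos (by linarith) (by linarith))
  have h2 : -a / (c + 1) * a + (-a / (c + 1)) ^ 2 * c = -(a / (c + 1)) ^ 2 := by
    field_simp; ring
  have h3 : 0 < (a / (c + 1)) ^ 2 := by
    have : a / (c + 1) ≠ 0 := div_ne_zero ha.ne (by linarith)
    positivity
  linarith

/-- If all but a fraction `α < 1 / 2` of the points lie within `r` of `c`, then the geometric
median is within `(1 - α) / √(1 - 2 α) * r` of `c`. -/
theorem IsGeometricMedian.mul_norm_sub_sq_le {k : ℕ} {p : Fin k → E} {z c : E} {r α : ℝ}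
    (hz : IsGeometricMedian p z) (hk : 0 < k) (hr : 0 ≤ r) (B : Finset (Fin k))
    (hB : (B.card : ℝ) ≤ α * k) (hα : α ≤ 1 / 2) (hp : ∀ l ∉ B, ‖p l - c‖ ≤ r) :
    (1 - 2 * α) * ‖z - c‖ ^ 2 ≤ (1 - α) ^ 2 * r ^ 2 := by
  have hk' : (0 : ℝ) < k := by exact_mod_cast hk
  have hb0 : (0 : ℝ) ≤ B.card := by positivity
  have hα0 : 0 ≤ α := by
    by_contra! h
    nlinarith
  rcases le_or_gt ‖z - c‖ r with hzr | hzr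
  · have : ‖z - c‖ ^ 2 ≤ r ^ 2 := by gcongr
    nlinarith [sq_nonneg α, sq_nonneg r, mul_nonneg (sq_nonneg α) (sq_nonneg r)]
  set v := c - z with hv
  have hvn : ‖z - c‖ = ‖v‖ := norm_sub_rev _ _
  rw [hvn] at hzr ⊢
  set q := √(‖v‖ ^ 2 - r ^ 2) with hq
  have hq2 : q ^ 2 = ‖v‖ ^ 2 - r ^ 2 := Real.sq_sqrt (by nlinarith)
  have hq0 : 0 ≤ q := Real.sqrt_nonneg _
  -- If `p l = z` this is `0` by division by zero. That is harmless: the quadratic bound is used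
  -- only for good points, which differ from `z`.
  set C : Fin k → ℝ := fun l => ‖v‖ ^ 2 / (2 * ‖p l - z‖)
  -- First-order optimality at `z` in the direction of `c`: a bad point increases the sum at rate at
  -- most `‖v‖`, a good one decreases it at rate at least `q`.
  have key : 0 ≤ ∑ l, (if l ∈ B then ‖v‖ else -q) := by
    refine nonneg_of_forall_mul_add_sq_nonneg (c := ∑ l, C l)
      (Finset.sum_nonneg fun l _ => by positivity) fun s hs => ?_
    have h1 := hz (z + s • v)
    have h2 : ∑ l, ‖z + s • v - p l‖ ≤
        ∑ l, (‖z - p l‖ + (s * (if l ∈ B then ‖v‖ else -q) + s ^ 2 * C l)) := by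
      refine Finset.sum_le_sum fun l _ => ?_
      have e1 : ‖z + s • v - p l‖ = ‖(p l - z) - s • v‖ := by
        rw [norm_sub_rev]; congr 1; abel
      have e2 : ‖z - p l‖ = ‖p l - z‖ := norm_sub_rev _ _
      have hC : 0 ≤ s ^ 2 * C l := by positivity
      rw [e1, e2]
      split_ifs with hl
      · have := norm_sub_le (p l - z) (s • v)
        rw [norm_smul, Real.norm_of_nonneg hs.le] at this
        linarith
      · have hd : ‖p l - z - v‖ ≤ r := by
          have : p l - z - v = p l - c := by rw [hv]; abel
          rw [this]; exact hp l hl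
        have hw : p l - z ≠ 0 := by
          intro h0
          rw [h0, zero_sub, norm_neg] at hd
          linarith
        have h3 := norm_sub_smul_le hw v s
        have h4 := mul_le_mul_of_nonneg_left (sqrt_le_inner_div_norm hw hd hzr.le) hs.le
        simp only [C]
        linarith
    rw [Finset.sum_add_distrib, Finset.sum_add_distrib, ← Finset.mul_sum, ← Finset.mul_sum] at h2
    linarith
  have hsum : ∑ l, (if l ∈ B then ‖v‖ else -q) = B.card * ‖v‖ - (k - B.card) * q := by
    have : ∀ l, (if l ∈ B then ‖v‖ else -q) = (if l ∈ B then ‖v‖ + q else 0) - q := by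
      intro l; split_ifs <;> ring
    simp_rw [this]
    rw [Finset.sum_sub_distrib, Finset.sum_ite_mem]
    simp
    ring
  rw [hsum] at key
  have h5 : (1 - α) * q ≤ α * ‖v‖ := by
    have : (k * ((1 - α) * q) : ℝ) ≤ k * (α * ‖v‖) := by
      nlinarith [norm_nonneg v]
    exact le_of_mul_le_mul_left this hk'
  have h6 : ((1 - α) * q) ^ 2 ≤ (α * ‖v‖) ^ 2 := by
    have : 0 ≤ (1 - α) * q := mul_nonneg (by linarith) hq0
    gcongr
  rw [mul_pow, mul_pow, hq2] at h6
  linarith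

end GeometricMedian

/-! ### Deterministic Lasso error under the restricted eigenvalue condition. -/

section Lasso

variable {n D : ℕ}

theorem l1Norm_coordRestrict (J : Finset (Fin D)) (u : EuclideanSpace ℝ (Fin D)) :
    l1Norm (coordRestrict J u) = ∑ i ∈ J, |u i| := by
  simp [l1Norm, coordRestrict, apply_ite abs, Finset.sum_ite_mem]

theorem norm_coordRestrict_sq (J : Finset (Fin D)) (u : EuclideanSpace ℝ (Fin D)) :
    ‖coordRestrict J u‖ ^ 2 = ∑ i ∈ J, u i ^ 2 := by
  simp [EuclideanSpace.norm_sq_eq, coordRestrict, Finset.sum_ite_mem, ite_pow]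

theorem inner_eq_sum_mul (u v : EuclideanSpace ℝ (Fin D)) :
    inner ℝ u v = ∑ i, u i * v i := by
  simp [PiLp.inner_apply, mul_comm]

/-- The basic inequality for the Lasso error, when the noise is dominated by the
regularization parameter. -/
theorem IsLasso.basic_inequality {x : Fin n → EuclideanSpace ℝ (Fin D)} {y ξ : Fin n → ℝ}
    {G : Finset (Fin n)} {ε : ℝ} {v v₀ : EuclideanSpace ℝ (Fin D)}
    (h : IsLasso x y G ε v) (hy : ∀ j, y j = inner ℝ v₀ (x j) + ξ j) (hG : 0 < G.card)
    (hε : 0 ≤ ε) (hξ : ∀ i, |∑ j ∈ G, ξ j * x j i| ≤ ε * G.card / 4) :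
    (∑ j ∈ G, (inner ℝ (v - v₀) (x j)) ^ 2) / G.card + ε / 2 * ∑ i, |(v - v₀) i| ≤
      2 * ε * ∑ i with v₀ i ≠ 0, |(v - v₀) i| := by
  set u := v - v₀ with hu
  have hm : (0 : ℝ) < G.card := by exact_mod_cast hG
  have h0 := h v₀
  have e1 : ∀ j, (y j - inner ℝ v (x j)) ^ 2 =
      ξ j ^ 2 - 2 * (ξ j * inner ℝ u (x j)) + (inner ℝ u (x j)) ^ 2 := by
    intro j
    rw [hy, hu, inner_sub_left]; ring
  have e2 : ∀ j, (y j - inner ℝ v₀ (x j)) ^ 2 = ξ j ^ 2 := by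
    intro j; rw [hy]; ring
  simp only [lassoObjective, e1, e2, Finset.sum_add_distrib, Finset.sum_sub_distrib,
    ← Finset.mul_sum] at h0
  have e3 : ∑ j ∈ G, ξ j * inner ℝ u (x j) ≤ ε * G.card / 4 * ∑ i, |u i| := by
    calc ∑ j ∈ G, ξ j * inner ℝ u (x j) = ∑ i, u i * ∑ j ∈ G, ξ j * x j i := by
          simp_rw [inner_eq_sum_mul, Finset.mul_sum]
          rw [Finset.sum_comm]
          exact Finset.sum_congr rfl fun i _ => Finset.sum_congr rfl fun j _ => by ring
      _ ≤ ∑ i, ε * G.card / 4 * |u i| := by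
          refine Finset.sum_le_sum fun i _ => (le_abs_self _).trans ?_
          rw [abs_mul, mul_comm]
          exact mul_le_mul_of_nonneg_right (hξ i) (abs_nonneg _)
      _ = _ := by rw [Finset.mul_sum]
  -- Off the support of `v₀` the terms cancel exactly; on it the reverse triangle inequality is
  -- used.
  have e4 : l1Norm v₀ - l1Norm v + ∑ i, |u i| ≤ 2 * ∑ i with v₀ i ≠ 0, |u i| := by
    simp only [l1Norm]
    rw [← Finset.sum_sub_distrib, ← Finset.sum_add_distrib, Finset.sum_filter, Finset.mul_sum]
    refine Finset.sum_le_sum fun i _ => ?_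
    have hui : u i = v i - v₀ i := by simp [hu]
    split_ifs with hi
    · have := abs_sub_abs_le_abs_sub (v₀ i) (v i)
      rw [abs_sub_comm, ← hui] at this
      linarith
    · have hi' : v₀ i = 0 := not_not.mp hi
      rw [hui, hi']; simp
  set Q := ∑ j ∈ G, (inner ℝ u (x j)) ^ 2
  set P := ∑ j ∈ G, ξ j * inner ℝ u (x j)
  have e5 : Q / G.card ≤ 2 * (P / G.card) + ε * (l1Norm v₀ - l1Norm v) := by
    have : 1 / (G.card : ℝ) * (∑ j ∈ G, ξ j ^ 2 - 2 * P + Q) =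
        1 / (G.card : ℝ) * ∑ j ∈ G, ξ j ^ 2 - 2 * (P / G.card) + Q / G.card := by ring
    linarith
  -- The threshold `ε / 4` makes the noise cost `ε / 2` times the `ℓ₁` error, half of what the
  -- penalty supplies through `e4`.
  have e6 : P / G.card ≤ ε / 4 * ∑ i, |u i| := by
    rw [div_le_iff₀ hm]; linarith
  have e7 := mul_le_mul_of_nonneg_left e4 hε
  linarith

/-- A vector of the cone `‖u_{Jᶜ}‖₁ ≤ 3 ‖u_J‖₁` is controlled by its restriction to a set with at
most twice as many elements as `J`. -/
theorem exists_superset_norm_sq_le {J : Finset (Fin D)} {s : ℕ} (hJ : J.card ≤ s)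
    {u : EuclideanSpace ℝ (Fin D)} (hu : ∑ i ∈ Jᶜ, |u i| ≤ 3 * ∑ i ∈ J, |u i|) :
    ∃ K, J ⊆ K ∧ K.card ≤ 2 * s ∧ ‖u‖ ^ 2 ≤ 10 * ‖coordRestrict K u‖ ^ 2 := by
  set a := ∑ i ∈ Jᶜ, |u i| with ha
  have ha0 : 0 ≤ a := Finset.sum_nonneg fun _ _ => abs_nonneg _
  -- `T` collects the coordinates above `a / s`. There are at most `s` of them, and the rest have
  -- squared sum at most `a² / s ≤ 9 ‖u_J‖²`, whence `10 = 1 + 9`.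
  set T := Jᶜ.filter (fun i => a < s * |u i|) with hT
  have hTs : T.card ≤ s := by
    rcases T.eq_empty_or_nonempty with h | h
    · simp [h]
    have h1 : (T.card : ℝ) * a < s * a := by
      calc (T.card : ℝ) * a = ∑ i ∈ T, a := by simp
        _ < ∑ i ∈ T, s * |u i| :=
          Finset.sum_lt_sum_of_nonempty h fun i hi => (Finset.mem_filter.mp hi).2
        _ = s * ∑ i ∈ T, |u i| := by rw [Finset.mul_sum]
        _ ≤ s * a := by
          refine mul_le_mul_of_nonneg_left ?_ (by positivity)
          exact Finset.sum_le_sum_of_subset_of_nonneg (Finset.filter_subset _ _)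
            fun _ _ _ => abs_nonneg _
    exact_mod_cast (lt_of_mul_lt_mul_right h1 ha0).le
  refine ⟨J ∪ T, Finset.subset_union_left, ?_, ?_⟩
  · have := Finset.card_union_le J T
    omega
  rw [norm_coordRestrict_sq, EuclideanSpace.norm_sq_eq]
  simp only [Real.norm_eq_abs, sq_abs]
  rw [← Finset.sum_add_sum_compl (J ∪ T)]
  have hJK : ∑ i ∈ J, u i ^ 2 ≤ ∑ i ∈ J ∪ T, u i ^ 2 :=
    Finset.sum_le_sum_of_subset_of_nonneg Finset.subset_union_left fun _ _ _ => sq_nonneg _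
  have h1 : (∑ i ∈ J, |u i|) ^ 2 ≤ s * ∑ i ∈ J, u i ^ 2 := by
    have := sq_sum_le_card_mul_sum_sq (s := J) (f := fun i => |u i|)
    simp only [sq_abs] at this
    refine this.trans (mul_le_mul_of_nonneg_right (by exact_mod_cast hJ) ?_)
    exact Finset.sum_nonneg fun _ _ => sq_nonneg _
  have h2 : s * ∑ i ∈ (J ∪ T)ᶜ, u i ^ 2 ≤ a ^ 2 := by
    calc s * ∑ i ∈ (J ∪ T)ᶜ, u i ^ 2 ≤ ∑ i ∈ (J ∪ T)ᶜ, a * |u i| := by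
          rw [Finset.mul_sum]
          refine Finset.sum_le_sum fun i hi => ?_
          have hi' : s * |u i| ≤ a := by
            by_contra! hlt
            simp [hT, hlt] at hi
          rw [← sq_abs]
          nlinarith [abs_nonneg (u i)]
      _ = a * ∑ i ∈ (J ∪ T)ᶜ, |u i| := by rw [Finset.mul_sum]
      _ ≤ a * a := by
          refine mul_le_mul_of_nonneg_left ?_ ha0
          refine Finset.sum_le_sum_of_subset_of_nonneg ?_ fun _ _ _ => abs_nonneg _
          exact Finset.compl_subset_compl.mpr Finset.subset_union_left
      _ = a ^ 2 := by ring
  have h3 : a ^ 2 ≤ 9 * (∑ i ∈ J, |u i|) ^ 2 := by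
    nlinarith
  rcases Nat.eq_zero_or_pos s with hs | hs
  · have hJe : J = ∅ := by
      rw [← Finset.card_eq_zero]; omega
    have hz : ∀ i, u i = 0 := by
      intro i
      simp only [hJe, Finset.sum_empty, mul_zero, Finset.compl_empty] at hu ha
      have := Finset.single_le_sum (f := fun i => |u i|) (fun _ _ => abs_nonneg _)
        (Finset.mem_univ i)
      exact abs_eq_zero.mp (le_antisymm (this.trans (ha ▸ hu)) (abs_nonneg _))
    simp [hz]
  · have hs' : (0 : ℝ) < s := by exact_mod_cast hs
    have h4 : s * ∑ i ∈ (J ∪ T)ᶜ, u i ^ 2 ≤ s * (9 * ∑ i ∈ J, u i ^ 2) := by linarith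
    have h5 := le_of_mul_le_mul_left h4 hs'
    linarith

/-- The error bound for the Lasso under a restricted eigenvalue condition, when the noise is
dominated by the regularization parameter. -/
theorem IsLasso.norm_sub_sq_le {x : Fin n → EuclideanSpace ℝ (Fin D)} {y ξ : Fin n → ℝ}
    {G : Finset (Fin n)} {ε : ℝ} {v v₀ : EuclideanSpace ℝ (Fin D)} {κ : ℝ≥0∞}
    (h : IsLasso x y G ε v) (hy : ∀ j, y j = inner ℝ v₀ (x j) + ξ j) (hG : 0 < G.card)
    (hε : 0 < ε) (hξ : ∀ i, |∑ j ∈ G, ξ j * x j i| ≤ ε * G.card / 4)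
    (hκ : κ ≤ restrictedEigenvalue x G (2 * supportSize v₀) 3) (hκ0 : 0 < κ) :
    ‖v - v₀‖ ^ 2 ≤ 45 / 2 * ε ^ 2 * supportSize v₀ / κ.toReal ^ 4 := by
  have hm : (0 : ℝ) < G.card := by exact_mod_cast hG
  have hbasic := h.basic_inequality hy hG hε.le hξ
  set u := v - v₀
  set J : Finset (Fin D) := Finset.univ.filter (fun i => v₀ i ≠ 0)
  set Q := ∑ j ∈ G, (inner ℝ u (x j)) ^ 2 with hQ
  have hQ0 : 0 ≤ Q := Finset.sum_nonneg fun _ _ => sq_nonneg _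
  have hQm : 0 ≤ Q / G.card := by positivity
  rw [← Finset.sum_add_sum_compl J] at hbasic
  have hJc0 : 0 ≤ ∑ i ∈ Jᶜ, |u i| := Finset.sum_nonneg fun _ _ => abs_nonneg _
  have hcone : ∑ i ∈ Jᶜ, |u i| ≤ 3 * ∑ i ∈ J, |u i| := by
    have : ε * ∑ i ∈ Jᶜ, |u i| ≤ ε * (3 * ∑ i ∈ J, |u i|) := by linarith
    exact le_of_mul_le_mul_left this hε
  rcases eq_or_ne u 0 with hu0 | hu0
  · rw [hu0, norm_zero, zero_pow two_ne_zero]; positivity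
  obtain ⟨K, hJK, hKc, hK⟩ := exists_superset_norm_sq_le (s := supportSize v₀) le_rfl hcone
  have hKcone : l1Norm (coordRestrict Kᶜ u) ≤ 3 * l1Norm (coordRestrict K u) := by
    rw [l1Norm_coordRestrict, l1Norm_coordRestrict]
    have h1 : ∑ i ∈ Kᶜ, |u i| ≤ ∑ i ∈ Jᶜ, |u i| :=
      Finset.sum_le_sum_of_subset_of_nonneg (Finset.compl_subset_compl.mpr hJK)
        fun _ _ _ => abs_nonneg _
    have h2 : ∑ i ∈ J, |u i| ≤ ∑ i ∈ K, |u i| :=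
      Finset.sum_le_sum_of_subset_of_nonneg hJK fun _ _ _ => abs_nonneg _
    linarith
  set w := ‖coordRestrict K u‖ with hw
  have hw0 : 0 < w := by
    have : 0 < ‖u‖ := norm_pos_iff.mpr hu0
    refine lt_of_le_of_ne (norm_nonneg _) fun h0 => ?_
    rw [← h0] at hK
    nlinarith
  have hκle : κ ≤ ENNReal.ofReal (√Q / (√(G.card : ℝ) * w)) :=
    hκ.trans (iInf_le_of_le K (iInf_le_of_le hKc (iInf_le_of_le u (iInf_le_of_le hu0
      (iInf_le_of_le hKcone le_rfl)))))
  have hκtop : κ ≠ ⊤ := ne_top_of_le_ne_top ENNReal.ofReal_ne_top hκle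
  have hr0 : 0 < κ.toReal := ENNReal.toReal_pos hκ0.ne' hκtop
  set r := κ.toReal
  have hr : r ≤ √Q / (√(G.card : ℝ) * w) := by
    have := ENNReal.toReal_mono ENNReal.ofReal_ne_top hκle
    rwa [ENNReal.toReal_ofReal (by positivity)] at this
  have hr2 : r ^ 2 * w ^ 2 ≤ Q / G.card := by
    rw [le_div_iff₀ (by positivity)] at hr
    have h1 : (r * (√(G.card : ℝ) * w)) ^ 2 ≤ √Q ^ 2 := by gcongr
    rw [Real.sq_sqrt hQ0, mul_pow, mul_pow, Real.sq_sqrt hm.le] at h1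
    rw [le_div_iff₀ hm]
    linarith
  have hJ1 : ∑ i ∈ J, |u i| ≤ √(supportSize v₀) * w := by
    refine le_of_sq_le_sq ?_ (by positivity)
    rw [mul_pow, Real.sq_sqrt (by positivity), hw, norm_coordRestrict_sq]
    have h1 := sq_sum_le_card_mul_sum_sq (s := J) (f := fun i => |u i|)
    simp only [sq_abs] at h1
    refine h1.trans (mul_le_mul_of_nonneg_left ?_ (by positivity))
    exact Finset.sum_le_sum_of_subset_of_nonneg hJK fun _ _ _ => sq_nonneg _
  -- The constant `3/2` is `2 - 1/2`, from the support terms of the basic inequality; squaring and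
  -- the factor `10` give `45/2`.
  have h7 : r ^ 2 * w ≤ 3 / 2 * ε * √(supportSize v₀) := by
    have h1 : Q / G.card ≤ 3 / 2 * ε * ∑ i ∈ J, |u i| := by
      have := mul_nonneg hε.le hJc0
      linarith
    have h2 : 3 / 2 * ε * ∑ i ∈ J, |u i| ≤ 3 / 2 * ε * (√(supportSize v₀) * w) := by gcongr
    have h3 : (r ^ 2 * w) * w ≤ (3 / 2 * ε * √(supportSize v₀)) * w := by linarith
    exact le_of_mul_le_mul_right h3 hw0
  have h8 : (r ^ 2 * w) ^ 2 ≤ (3 / 2 * ε * √(supportSize v₀)) ^ 2 := by gcongr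
  rw [mul_pow (3 / 2 * ε), Real.sq_sqrt (by positivity)] at h8
  rw [le_div_iff₀ (by positivity)]
  calc ‖u‖ ^ 2 * r ^ 4 ≤ 10 * w ^ 2 * r ^ 4 := by gcongr
    _ = 10 * (r ^ 2 * w) ^ 2 := by ring
    _ ≤ 10 * ((3 / 2 * ε) ^ 2 * supportSize v₀) := by gcongr
    _ = _ := by ring

end Lasso

/-! ### Maximal inequality for weighted sums of noise with finite variance. -/

section LogSumExp

variable {ι : Type*} [Fintype ι]

/-- Hoeffding's lemma for a finitely supported distribution. -/
theorem sum_mul_exp_le {p z : ι → ℝ} (hp : ∀ i, 0 ≤ p i) (hp1 : ∑ i, p i = 1) {c : ℝ}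
    (hz : ∀ i, |z i| ≤ c) :
    ∑ i, p i * Real.exp (z i) ≤ Real.exp (∑ i, p i * z i + c ^ 2 / 2) := by
  let _ : MeasurableSpace ι := ⊤
  have hsum : ∑ i, ENNReal.ofReal (p i) = 1 := by
    rw [← ENNReal.ofReal_sum_of_nonneg fun i _ => hp i, hp1, ENNReal.ofReal_one]
  set P : PMF ι := PMF.ofFintype (fun i => ENNReal.ofReal (p i)) hsum
  have hint : ∀ f : ι → ℝ, ∫ i, f i ∂P.toMeasure = ∑ i, p i * f i := by
    intro f
    rw [PMF.integral_eq_sum]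
    exact Finset.sum_congr rfl fun i _ => by simp [P, ENNReal.toReal_ofReal (hp i)]
  have h := (hasSubgaussianMGF_of_mem_Icc (μ := P.toMeasure) (X := z) (a := -c) (b := c)
    (Measurable.of_discrete).aemeasurable
    (Filter.Eventually.of_forall fun i => abs_le.mp (hz i))).mgf_le 1
  rw [mgf, hint, hint] at h
  have e : (((‖c - -c‖₊ / 2) ^ 2 : NNReal) : ℝ) = c ^ 2 := by
    push_cast
    rw [Real.norm_eq_abs, div_pow, sq_abs]; ring
  rw [e, one_pow, mul_one] at h
  rw [Real.exp_add]
  calc ∑ i, p i * Real.exp (z i)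
      = Real.exp (∑ i, p i * z i) *
        ∑ i, p i * Real.exp (1 * (z i - ∑ i, p i * z i)) := by
        rw [Finset.mul_sum]
        refine Finset.sum_congr rfl fun i _ => ?_
        rw [one_mul, Real.exp_sub]
        field_simp
    _ ≤ _ := mul_le_mul_of_nonneg_left h (Real.exp_pos _).le

/-- The function `s ↦ log (∑ i, exp (s i))`, a smooth upper bound for the maximum. -/
noncomputable def logSumExp (s : ι → ℝ) : ℝ := Real.log (∑ i, Real.exp (s i))

/-- The gradient of `logSumExp`. -/
noncomputable def softmax (s : ι → ℝ) (i : ι) : ℝ := Real.exp (s i) / ∑ j, Real.exp (s j)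

theorem softmax_nonneg (s : ι → ℝ) (i : ι) : 0 ≤ softmax s i :=
  div_nonneg (Real.exp_pos _).le (Finset.sum_nonneg fun _ _ => (Real.exp_pos _).le)

theorem sum_exp_pos [Nonempty ι] (s : ι → ℝ) : 0 < ∑ i, Real.exp (s i) :=
  Finset.sum_pos (fun _ _ => Real.exp_pos _) Finset.univ_nonempty

theorem sum_softmax [Nonempty ι] (s : ι → ℝ) : ∑ i, softmax s i = 1 := by
  simp only [softmax]
  rw [← Finset.sum_div, div_self (sum_exp_pos s).ne']

theorem le_logSumExp (s : ι → ℝ) (i : ι) : s i ≤ logSumExp s := by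
  have : Nonempty ι := ⟨i⟩
  rw [logSumExp, Real.le_log_iff_exp_le (sum_exp_pos s)]
  exact Finset.single_le_sum (f := fun i => Real.exp (s i)) (fun _ _ => (Real.exp_pos _).le)
    (Finset.mem_univ i)

/-- The increment is the log-moment generating function of `z` under the softmax weights, so
Hoeffding's lemma bounds it by the gradient term plus `c² / 2`. -/
theorem logSumExp_add_le [Nonempty ι] (s : ι → ℝ) {z : ι → ℝ} {c : ℝ} (hz : ∀ i, |z i| ≤ c) :
    logSumExp (s + z) ≤ logSumExp s + (∑ i, softmax s i * z i + c ^ 2 / 2) := by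
  have hpos := sum_exp_pos s
  have h := sum_mul_exp_le (softmax_nonneg s) (sum_softmax s) hz
  rw [logSumExp, logSumExp, ← Real.log_exp (∑ i, softmax s i * z i + c ^ 2 / 2),
    ← Real.log_mul hpos.ne' (Real.exp_pos _).ne']
  refine Real.log_le_log (sum_exp_pos _) ?_
  calc ∑ i, Real.exp ((s + z) i) = (∑ i, Real.exp (s i)) * ∑ i, softmax s i * Real.exp (z i) := by
        rw [Finset.mul_sum]
        refine Finset.sum_congr rfl fun i _ => ?_
        rw [softmax, Pi.add_apply, Real.exp_add]
        field_simp
    _ ≤ _ := by gcongr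

theorem measurable_logSumExp : Measurable (logSumExp : (ι → ℝ) → ℝ) := by
  unfold logSumExp; fun_prop

theorem measurable_softmax (i : ι) : Measurable fun s : ι → ℝ => softmax s i := by
  unfold softmax; fun_prop

theorem abs_logSumExp_le [Nonempty ι] (s : ι → ℝ) :
    |logSumExp s| ≤ Real.log (Fintype.card ι) + ∑ i, |s i| := by
  have hc : (1 : ℝ) ≤ Fintype.card ι := by exact_mod_cast Fintype.card_pos
  have hl := Real.log_nonneg hc
  have hs : ∀ i, |s i| ≤ ∑ i, |s i| := fun i =>
    Finset.single_le_sum (f := fun i => |s i|) (fun _ _ => abs_nonneg _) (Finset.mem_univ i)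
  rw [abs_le]
  constructor
  · obtain ⟨i⟩ := ‹Nonempty ι›
    have h1 := le_logSumExp s i
    have h2 := neg_abs_le (s i)
    have h3 := hs i
    linarith
  · rw [logSumExp, Real.log_le_iff_le_exp (sum_exp_pos s), Real.exp_add,
      Real.exp_log (by linarith)]
    calc ∑ i, Real.exp (s i) ≤ ∑ _i : ι, Real.exp (∑ i, |s i|) :=
          Finset.sum_le_sum fun i _ => Real.exp_le_exp.mpr ((le_abs_self _).trans (hs i))
      _ = _ := by simp

variable {Ω κ : Type*} [MeasurableSpace Ω] {μ : Measure Ω} [IsProbabilityMeasure μ]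

/-- A maximal inequality of Nemirovski type, for the smooth maximum of the coordinates of a sum of
independent centered random vectors. -/
theorem integral_logSumExp_sum_le [Nonempty ι] {ξ : κ → Ω → ℝ} (hmeas : ∀ j, Measurable (ξ j))
    (hindep : iIndepFun ξ μ) (hL2 : ∀ j, MemLp (ξ j) 2 μ) (hmean : ∀ j, ∫ ω, ξ j ω ∂μ = 0)
    {a : κ → ι → ℝ} {B : ℝ} (ha : ∀ j i, |a j i| ≤ B) (A : Finset κ) :
    Integrable (fun ω => logSumExp fun i => ∑ j ∈ A, ξ j ω * a j i) μ ∧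
    ∫ ω, logSumExp (fun i => ∑ j ∈ A, ξ j ω * a j i) ∂μ ≤
      Real.log (Fintype.card ι) + B ^ 2 / 2 * ∑ j ∈ A, ∫ ω, ξ j ω ^ 2 ∂μ := by
  classical
  have hint : ∀ j, Integrable (ξ j) μ := fun j => (hL2 j).integrable one_le_two
  have hI : ∀ A : Finset κ, Integrable (fun ω => logSumExp fun i => ∑ j ∈ A, ξ j ω * a j i) μ := by
    intro A
    have hb : Integrable (fun ω => Real.log (Fintype.card ι) + ∑ i, |∑ j ∈ A, ξ j ω * a j i|) μ :=
      (integrable_const _).add (integrable_finsetSum _ fun i _ =>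
        (integrable_finsetSum _ fun j _ => (hint j).mul_const _).abs)
    refine hb.mono' ?_ (Filter.Eventually.of_forall fun ω => abs_logSumExp_le _)
    exact (measurable_logSumExp.comp (measurable_pi_lambda _ fun i =>
      Finset.measurable_sum _ fun j _ => (hmeas j).mul_const _)).aestronglyMeasurable
  refine ⟨hI A, ?_⟩
  induction A using Finset.induction_on with
  | empty => simp [logSumExp]
  | insert j A hj ih =>
    set S : Ω → ι → ℝ := fun ω i => ∑ j ∈ A, ξ j ω * a j i with hS
    have hSm : Measurable S := measurable_pi_lambda _ fun i =>
      Finset.measurable_sum _ fun j _ => (hmeas j).mul_const _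
    set W : (ι → ℝ) → ℝ := fun s => ∑ i, softmax s i * a j i with hW
    have hWm : Measurable W :=
      Finset.measurable_sum _ fun i _ => (measurable_softmax i).mul_const _
    have hind : IndepFun (fun ω => W (S ω)) (ξ j) μ := by
      -- Pairing the scalar with its vector lets one independent family provide both the partial
      -- vector sum and the next scalar.
      have h1 : iIndepFun (fun j ω => (ξ j ω, fun i => ξ j ω * a j i)) μ :=
        hindep.comp (fun j r => (r, fun i => r * a j i)) fun j => by fun_prop
      have h2 := h1.indepFun_finsetSum_of_notMem
        (fun j => by have := hmeas j; fun_prop) hj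
      have h3 := h2.comp (hWm.comp measurable_snd) measurable_fst
      refine h3.congr (Filter.EventuallyEq.of_eq ?_) (Filter.EventuallyEq.of_eq rfl)
      funext ω
      simp only [Function.comp_apply, Finset.sum_apply, Prod.snd_sum]
      congr 1
      funext i
      simp [hS]
    have hzero : ∫ ω, W (S ω) * ξ j ω ∂μ = 0 := by
      rw [hind.integral_fun_mul_eq_mul_integral (hWm.comp hSm).aestronglyMeasurable
        (hmeas j).aestronglyMeasurable, hmean j, mul_zero]
    have hWb : ∀ s, |W s| ≤ B := by
      intro s
      calc |W s| ≤ ∑ i, |softmax s i * a j i| := Finset.abs_sum_le_sum_abs _ _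
        _ ≤ ∑ i, softmax s i * B := by
          refine Finset.sum_le_sum fun i _ => ?_
          rw [abs_mul, abs_of_nonneg (softmax_nonneg s i)]
          exact mul_le_mul_of_nonneg_left (ha j i) (softmax_nonneg s i)
        _ = B := by rw [← Finset.sum_mul, sum_softmax, one_mul]
    have hWi : Integrable (fun ω => W (S ω) * ξ j ω) μ :=
      (hint j).bdd_mul (hWm.comp hSm).aestronglyMeasurable
        (Filter.Eventually.of_forall fun ω => hWb (S ω))
    have hsq : Integrable (fun ω => B ^ 2 / 2 * ξ j ω ^ 2) μ := (hL2 j).integrable_sq.const_mul _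
    have hstep : ∀ ω, logSumExp (fun i => ∑ j ∈ insert j A, ξ j ω * a j i) ≤
        logSumExp (S ω) + (W (S ω) * ξ j ω + B ^ 2 / 2 * ξ j ω ^ 2) := by
      intro ω
      have e1 : (fun i => ∑ j ∈ insert j A, ξ j ω * a j i) = S ω + fun i => ξ j ω * a j i := by
        funext i
        rw [Finset.sum_insert hj, add_comm]; rfl
      -- The range `c` depends on `ω`, so no bound on the noise is needed: its square integrates to
      -- a variance term.
      have h := logSumExp_add_le (S ω) (z := fun i => ξ j ω * a j i) (c := |ξ j ω| * B)
        fun i => by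
          rw [abs_mul]; exact mul_le_mul_of_nonneg_left (ha j i) (abs_nonneg _)
      have e2 : ∑ i, softmax (S ω) i * (ξ j ω * a j i) = W (S ω) * ξ j ω := by
        rw [hW, Finset.sum_mul]
        exact Finset.sum_congr rfl fun i _ => by ring
      rw [e1]
      rw [e2, mul_pow, sq_abs] at h
      linarith
    have hmono := integral_mono (hI (insert j A)) ((hI A).add (hWi.add hsq)) hstep
    rw [integral_add' (hI A) (hWi.add hsq), integral_add' hWi hsq, hzero,
      integral_const_mul] at hmono
    rw [Finset.sum_insert hj]
    linarith

/-- The tail bound for the sup-norm of a weighted sum of independent centered random variables,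
with a free parameter `b`. -/
theorem measureReal_exists_lt_abs_sum_le {ι : Type*} [Fintype ι] [Nonempty ι] {ξ : κ → Ω → ℝ}
    (hmeas : ∀ j, Measurable (ξ j))
    (hindep : iIndepFun ξ μ) (hL2 : ∀ j, MemLp (ξ j) 2 μ) (hmean : ∀ j, ∫ ω, ξ j ω ∂μ = 0)
    {σ : ℝ} (hvar : ∀ j, variance (ξ j) μ ≤ σ ^ 2)
    {a : κ → ι → ℝ} {M : ℝ} (ha : ∀ j i, |a j i| ≤ M) (A : Finset κ) {b η : ℝ} (hb : 0 < b) :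
    b * η * μ.real {ω | ∃ i, η < |∑ j ∈ A, ξ j ω * a j i|} ≤
      Real.log (2 * Fintype.card ι) + b ^ 2 * M ^ 2 / 2 * (A.card * σ ^ 2) := by
  -- Both signs of each coordinate turn the maximum into a sup-norm, which is why `2 D` appears in
  -- the logarithm.
  set a' : κ → ι ⊕ ι → ℝ := fun j => Sum.elim (fun i => b * a j i) (fun i => -(b * a j i))
    with ha'
  have ha'b : ∀ j i, |a' j i| ≤ b * M := by
    rintro j (i | i)
    · simp only [ha', Sum.elim_inl, abs_mul, abs_of_pos hb]
      exact mul_le_mul_of_nonneg_left (ha j i) hb.le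
    · simp only [ha', Sum.elim_inr, abs_neg, abs_mul, abs_of_pos hb]
      exact mul_le_mul_of_nonneg_left (ha j i) hb.le
  obtain ⟨hI, hE⟩ := integral_logSumExp_sum_le hmeas hindep hL2 hmean ha'b A
  set F : Ω → ℝ := fun ω => logSumExp fun i => ∑ j ∈ A, ξ j ω * a' j i with hF
  have hFle : ∀ ω i, b * |∑ j ∈ A, ξ j ω * a j i| ≤ F ω := by
    intro ω i
    have h1 := le_logSumExp (fun i => ∑ j ∈ A, ξ j ω * a' j i) (Sum.inl i)
    have h2 := le_logSumExp (fun i => ∑ j ∈ A, ξ j ω * a' j i) (Sum.inr i)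
    have e1 : ∑ j ∈ A, ξ j ω * a' j (Sum.inl i) = b * ∑ j ∈ A, ξ j ω * a j i := by
      rw [Finset.mul_sum]
      exact Finset.sum_congr rfl fun j _ => by simp only [ha', Sum.elim_inl]; ring
    have e2 : ∑ j ∈ A, ξ j ω * a' j (Sum.inr i) = -(b * ∑ j ∈ A, ξ j ω * a j i) := by
      rw [Finset.mul_sum, ← Finset.sum_neg_distrib]
      exact Finset.sum_congr rfl fun j _ => by simp only [ha', Sum.elim_inr]; ring
    rw [e1] at h1
    rw [e2] at h2
    rw [show b * |∑ j ∈ A, ξ j ω * a j i| = |b * ∑ j ∈ A, ξ j ω * a j i| by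
      rw [abs_mul, abs_of_pos hb]]
    exact abs_le'.mpr ⟨h1, h2⟩
  have hF0 : ∀ ω, 0 ≤ F ω := fun ω =>
    (mul_nonneg hb.le (abs_nonneg _)).trans (hFle ω (Classical.arbitrary ι))
  have hmarkov := mul_meas_ge_le_integral_of_nonneg (μ := μ)
    (Filter.Eventually.of_forall hF0) hI (b * η)
  have hEb : ∫ ω, F ω ∂μ ≤
      Real.log (2 * Fintype.card ι) + b ^ 2 * M ^ 2 / 2 * (A.card * σ ^ 2) := by
    have h1 : ∑ j ∈ A, ∫ ω, ξ j ω ^ 2 ∂μ ≤ A.card * σ ^ 2 := by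
      rw [← nsmul_eq_mul]
      refine Finset.sum_le_card_nsmul _ _ _ fun j _ => ?_
      rw [← variance_of_integral_eq_zero (hmeas j).aemeasurable (hmean j)]
      exact hvar j
    have h2 : ((Fintype.card (ι ⊕ ι) : ℕ) : ℝ) = 2 * Fintype.card ι := by
      rw [Fintype.card_sum]; push_cast; ring
    rw [h2] at hE
    refine hE.trans ?_
    rw [mul_pow]
    gcongr
  rcases le_or_gt 0 η with hη | hη
  · refine le_trans ?_ (hmarkov.trans hEb)
    refine mul_le_mul_of_nonneg_left (measureReal_mono ?_) (by positivity)
    rintro ω ⟨i, hi⟩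
    exact (mul_le_mul_of_nonneg_left hi.le hb.le).trans (hFle ω i)
  · refine le_trans ?_ ((integral_nonneg hF0).trans hEb)
    exact mul_nonpos_of_nonpos_of_nonneg (mul_nonpos_of_nonneg_of_nonpos hb.le hη.le)
      measureReal_nonneg

end LogSumExp

/-! ### Independence across blocks and the Chernoff bound. -/

section Blocks

variable {Ω ι κ : Type*} [MeasurableSpace Ω] {μ : Measure Ω} [IsProbabilityMeasure μ]

/-- Multiplicativity of the moment generating function for functions of disjoint groups of
independent random variables. -/
theorem mgf_sum_of_disjoint [Finite ι] [DecidableEq ι] {ξ : ι → Ω → ℝ}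
    (hmeas : ∀ j, Measurable (ξ j))
    (hindep : iIndepFun ξ μ) {G : κ → Finset ι} (hG : Pairwise fun l l' => Disjoint (G l) (G l'))
    {φ : κ → (ι → ℝ) → ℝ} (hφ : ∀ l, Measurable (φ l)) (t : ℝ) (A : Finset κ) :
    mgf (fun ω => ∑ l ∈ A, φ l (fun i => if i ∈ G l then ξ i ω else 0)) μ t =
      ∏ l ∈ A, mgf (fun ω => φ l (fun i => if i ∈ G l then ξ i ω else 0)) μ t := by
  classical
  have hm : ∀ l, Measurable fun ω => φ l (fun i => if i ∈ G l then ξ i ω else 0) := by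
    intro l
    refine (hφ l).comp (measurable_pi_lambda _ fun i => ?_)
    split_ifs
    exacts [hmeas i, measurable_const]
  induction A using Finset.induction_on with
  | empty => simp
  | insert l A hl ih =>
    rw [Finset.prod_insert hl, ← ih]
    have hdisj : Disjoint (G l) (A.biUnion G) := by
      rw [Finset.disjoint_biUnion_right]
      exact fun l' hl' => hG fun h => hl (h ▸ hl')
    have hΦ : ∀ (S : Finset ι) (l : κ),
        Measurable fun y : S → ℝ => φ l (fun i => if h : i ∈ S ∧ i ∈ G l then y ⟨i, h.1⟩ else 0) := by
      intro S l
      refine (hφ l).comp (measurable_pi_lambda _ fun i => ?_)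
      split_ifs
      exacts [measurable_pi_apply _, measurable_const]
    have h1 := (hindep.indepFun_finset (G l) (A.biUnion G) hdisj hmeas).comp (hΦ (G l) l)
      (Finset.measurable_sum A fun l' _ => hΦ (A.biUnion G) l')
    have h2 : IndepFun (fun ω => φ l (fun i => if i ∈ G l then ξ i ω else 0))
        (fun ω => ∑ l ∈ A, φ l (fun i => if i ∈ G l then ξ i ω else 0)) μ := by
      refine h1.congr (Filter.EventuallyEq.of_eq ?_) (Filter.EventuallyEq.of_eq ?_)
      · funext ω
        simp only [Function.comp_apply, and_self]
        rfl
      · funext ω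
        simp only [Function.comp_apply]
        refine Finset.sum_congr rfl fun l' hl' => ?_
        congr 1
        funext i
        by_cases hi : i ∈ G l'
        · have : i ∈ A.biUnion G := Finset.mem_biUnion.mpr ⟨l', hl', hi⟩
          simp only [this, hi, and_self, dite_true, if_true]
        · simp [hi]
    have h3 := h2.mgf_add (t := t)
      (((hm l).const_mul t).exp.aestronglyMeasurable)
      (((Finset.measurable_sum A fun l _ => hm l).const_mul t).exp.aestronglyMeasurable)
    rw [← h3]
    congr 1
    funext ω
    rw [Finset.sum_insert hl]; rfl

/-- A Chernoff bound for the number of bad groups among `k` independent ones, each of which is bad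
with probability at most `0.137`. -/
theorem measureReal_card_gt_le {k : ℕ} [Finite ι] [DecidableEq ι] {ξ : ι → Ω → ℝ}
    (hmeas : ∀ j, Measurable (ξ j)) (hindep : iIndepFun ξ μ) {G : Fin k → Finset ι}
    (hG : Pairwise fun l l' => Disjoint (G l) (G l')) {b : Fin k → (ι → ℝ) → Prop}
    [∀ l y, Decidable (b l y)] (hb : ∀ l, MeasurableSet {y | b l y})
    (hp : ∀ l, μ.real {ω | b l (fun i => if i ∈ G l then ξ i ω else 0)} ≤ 137 / 1000) {t : ℝ}
    (ht : 7 / 2 * t ≤ k) :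
    μ.real {ω | (23 / 50 : ℝ) * k ≤ ((Finset.univ.filter fun l =>
      b l (fun i => if i ∈ G l then ξ i ω else 0)).card : ℝ)} ≤ Real.exp (-t) := by
  classical
  set φ : Fin k → (ι → ℝ) → ℝ := fun l => {y | b l y}.indicator 1 with hφ
  have hφm : ∀ l, Measurable (φ l) := fun l => measurable_one.indicator (hb l)
  set ζ : Fin k → Ω → ι → ℝ := fun l ω i => if i ∈ G l then ξ i ω else 0 with hζ
  have hζm : ∀ l, Measurable (ζ l) := by
    refine fun l => measurable_pi_lambda _ fun i => ?_
    simp only [hζ]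
    split_ifs
    exacts [hmeas i, measurable_const]
  -- With this `θ`, the moment generating function of each bad-block indicator is at most `1 + 3 *
  -- 0.137 = 1.411`.
  set θ := Real.log 4 with hθ
  have hθ0 : 0 ≤ θ := Real.log_nonneg (by norm_num)
  have heθ : Real.exp θ = 4 := Real.exp_log (by norm_num)
  have hmgf : ∀ l, mgf (fun ω => φ l (ζ l ω)) μ θ ≤ 1411 / 1000 := by
    intro l
    have hset : MeasurableSet {ω | b l (ζ l ω)} := hζm l (hb l)
    have e : ∀ ω, Real.exp (θ * φ l (ζ l ω)) =
        1 + {ω | b l (ζ l ω)}.indicator (fun _ => (3 : ℝ)) ω := by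
      intro ω
      by_cases h : b l (ζ l ω)
      · simp [hφ, h, heθ]; norm_num
      · simp [hφ, h]
    rw [mgf]
    simp_rw [e]
    rw [integral_add (integrable_const _) ((integrable_const _).indicator hset),
      integral_indicator_const _ hset]
    have := hp l
    simp only [integral_const, probReal_univ, smul_eq_mul, mul_one]
    linarith
  have hcard : ∀ ω, ((Finset.univ.filter fun l => b l (ζ l ω)).card : ℝ) =
      ∑ l, φ l (ζ l ω) := by
    intro ω
    rw [Finset.card_filter]
    push_cast
    exact Finset.sum_congr rfl fun l _ => by simp [hφ, Set.indicator_apply]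
  have hsm : Measurable fun ω => ∑ l, φ l (ζ l ω) :=
    Finset.measurable_sum _ fun l _ => (hφm l).comp (hζm l)
  have hint : Integrable (fun ω => Real.exp (θ * ∑ l, φ l (ζ l ω))) μ := by
    refine Integrable.of_bound (C := Real.exp (θ * k)) (hsm.const_mul θ).exp.aestronglyMeasurable
      (Filter.Eventually.of_forall fun ω => ?_)
    rw [Real.norm_of_nonneg (Real.exp_pos _).le, ← hcard]
    gcongr
    exact (Finset.card_le_univ _).trans (by simp)
  have hch := measure_ge_le_exp_mul_mgf (μ := μ) (X := fun ω => ∑ l, φ l (ζ l ω))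
    ((23 / 50 : ℝ) * k) hθ0 hint
  rw [mgf_sum_of_disjoint hmeas hindep hG hφm θ Finset.univ] at hch
  have hset : {ω | (23 / 50 : ℝ) * k ≤ ((Finset.univ.filter fun l => b l (ζ l ω)).card : ℝ)} =
      {ω | (23 / 50 : ℝ) * k ≤ ∑ l, φ l (ζ l ω)} := by
    ext ω
    simp only [Set.mem_ofPred_eq, ← hcard]
  refine (congrArg μ.real hset).trans_le ?_
  refine hch.trans ?_
  have hprod : ∏ l, mgf (fun ω => φ l (ζ l ω)) μ θ ≤ (1411 / 1000) ^ k := by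
    calc _ ≤ ∏ _l : Fin k, (1411 / 1000 : ℝ) :=
          Finset.prod_le_prod (fun l _ => mgf_nonneg) fun l _ => hmgf l
      _ = _ := by rw [Finset.prod_const, Finset.card_univ, Fintype.card_fin]
  -- This is `1.411 ≤ 4 ^ 0.46 * exp (-2/7)`, the exponential rate `2/7` per block.
  have hnum : (1411 / 1000 : ℝ) ≤ Real.exp (23 / 50 * θ - 2 / 7) := by
    have h1 : θ = 2 * Real.log 2 := by
      rw [hθ, show (4 : ℝ) = 2 ^ 2 by norm_num, Real.log_pow]; norm_num
    have h2 := Real.log_two_gt_d9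
    have h3 : (3519 / 10000 : ℝ) ≤ 23 / 50 * θ - 2 / 7 := by rw [h1]; linarith
    have h4 := Real.quadratic_le_exp_of_nonneg (x := 3519 / 10000) (by norm_num)
    have h5 := Real.exp_le_exp.mpr h3
    norm_num at h4
    linarith
  calc Real.exp (-θ * (23 / 50 * k)) * ∏ l, mgf (fun ω => φ l (ζ l ω)) μ θ
      ≤ Real.exp (-θ * (23 / 50 * k)) * Real.exp (23 / 50 * θ - 2 / 7) ^ k := by
        gcongr
        exact hprod.trans (by gcongr)
    _ = Real.exp (-(2 / 7 * k)) := by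
        rw [← Real.exp_nat_mul, ← Real.exp_add]
        congr 1; ring
    _ ≤ Real.exp (-t) := Real.exp_le_exp.mpr (by linarith)

theorem card_block {n m l : ℕ} (h : (l + 1) * m ≤ n) : (block n m l).card = m := by
  have : (block n m l).map Fin.valEmbedding = Finset.Ico (l * m) ((l + 1) * m) := by
    ext j
    simp only [block, Finset.mem_map, Finset.mem_filter, Finset.mem_univ, true_and,
      Fin.valEmbedding_apply, Finset.mem_Ico]
    constructor
    · rintro ⟨i, hi, rfl⟩; exact hi
    · intro hj; exact ⟨⟨j, by omega⟩, hj, rfl⟩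
  rw [← Finset.card_map Fin.valEmbedding, this, Nat.card_Ico, add_mul, one_mul]
  omega

theorem disjoint_block {n m l l' : ℕ} (h : l ≠ l') : Disjoint (block n m l) (block n m l') := by
  rw [Finset.disjoint_left]
  intro j hj hj'
  simp only [block, Finset.mem_filter, Finset.mem_univ, true_and] at hj hj'
  rcases lt_or_gt_of_ne h with h | h
  · have := Nat.mul_le_mul_right m (Nat.succ_le_of_lt h)
    simp only [Nat.succ_eq_add_one] at this
    omega
  · have := Nat.mul_le_mul_right m (Nat.succ_le_of_lt h)
    simp only [Nat.succ_eq_add_one] at this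
    omega

end Blocks

/-! ### Numerical constants for a single block. -/

/-- The noise level of one block, for the regularization parameter of the theorem. -/
theorem noise_level_le {n k m : ℕ} {M σ t ε L : ℝ} (ht : 0 < t) (hk : (k : ℝ) ≤ 7 / 2 * t + 1)
    (hm : 2 ≤ m) (hn : 0 < n) (hnk : n ≤ k * (m + 1)) (hM : 0 ≤ M) (hσ : 0 ≤ σ) (hL : 0 ≤ L)
    (hε : 95 * M * σ * √((t + 2 / 7) / n * L) ≤ ε) :
    9025 * (M ^ 2 * σ ^ 2) * L ≤ 21 / 4 * m * ε ^ 2 := by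
  have hm' : (2 : ℝ) ≤ m := by exact_mod_cast hm
  have hn' : (0 : ℝ) < n := by exact_mod_cast hn
  have hnk' : (n : ℝ) ≤ k * (m + 1) := by exact_mod_cast hnk
  have h1 : (95 * M * σ * √((t + 2 / 7) / n * L)) ^ 2 ≤ ε ^ 2 := by gcongr
  rw [mul_pow, Real.sq_sqrt (by positivity)] at h1
  have h2 : (n : ℝ) ≤ 21 / 4 * m * (t + 2 / 7) := by
    calc (n : ℝ) ≤ k * (m + 1) := hnk'
      -- Since `m ≥ 2`, `m + 1 ≤ 3/2 * m`; the `2/7` in the condition on `ε` comes from the `+ 1` in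
      -- `k`.
      _ ≤ (7 / 2 * t + 1) * (3 / 2 * m) := by gcongr; linarith
      _ = _ := by ring
  have h3 : 1 ≤ 21 / 4 * m * ((t + 2 / 7) / n) := by
    rw [← mul_div_assoc, le_div_iff₀ hn']; linarith
  calc 9025 * (M ^ 2 * σ ^ 2) * L ≤ 9025 * (M ^ 2 * σ ^ 2) * L * (21 / 4 * m * ((t + 2 / 7) / n)) :=
        le_mul_of_one_le_right (by positivity) h3
    _ = 21 / 4 * m * ((95 * M * σ) ^ 2 * ((t + 2 / 7) / n * L)) := by ring
    _ ≤ _ := by gcongr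

/-- The probability that the noise of a group of size `m` is not dominated by the regularization
parameter. -/
theorem measureReal_noise_gt_le {Ω κ : Type*} [MeasurableSpace Ω] {μ : Measure Ω}
    [IsProbabilityMeasure μ] {D : ℕ} (hD : 0 < D) {ξ : κ → Ω → ℝ}
    (hmeas : ∀ j, Measurable (ξ j)) (hindep : iIndepFun ξ μ) (hL2 : ∀ j, MemLp (ξ j) 2 μ)
    (hmean : ∀ j, ∫ ω, ξ j ω ∂μ = 0) {σ : ℝ} (hvar : ∀ j, variance (ξ j) μ ≤ σ ^ 2)
    {x : κ → EuclideanSpace ℝ (Fin D)} {M ε : ℝ} (hM : ∀ j i, |x j i| ≤ M) (A : Finset κ)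
    (hA : 0 < A.card) (hε : 0 < ε)
    (hnoise : 9025 * (M ^ 2 * σ ^ 2) * Real.log (2 * D) ≤ 21 / 4 * A.card * ε ^ 2) :
    μ.real {ω | ∃ i, ε * A.card / 4 < |∑ j ∈ A, ξ j ω * x j i|} ≤ 137 / 1000 := by
  have : Nonempty (Fin D) := ⟨⟨0, hD⟩⟩
  have hm : (0 : ℝ) < A.card := by exact_mod_cast hA
  have hL : 0 < Real.log (2 * D) := by
    refine Real.log_pos ?_
    have : (1 : ℝ) ≤ D := by exact_mod_cast hD
    linarith
  set L := Real.log (2 * D)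
  -- Chosen to nearly balance the two terms of the tail bound, which become `L` and about `1.01 *
  -- L`, against a left side `59/4 * L * P`.
  set b := 59 * L / (A.card * ε) with hb
  have h := measureReal_exists_lt_abs_sum_le hmeas hindep hL2 hmean hvar hM A
    (b := b) (η := ε * A.card / 4) (by positivity)
  rw [Fintype.card_fin] at h
  have e1 : b * (ε * A.card / 4) = 59 / 4 * L := by
    rw [hb]; field_simp
  have e2 : b ^ 2 * M ^ 2 / 2 * (A.card * σ ^ 2) =
      3481 / 18050 * L / (A.card * ε ^ 2) * (9025 * (M ^ 2 * σ ^ 2) * L) := by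
    rw [hb]; field_simp; ring
  have e3 : b ^ 2 * M ^ 2 / 2 * (A.card * σ ^ 2) ≤ 3481 / 18050 * (21 / 4) * L := by
    rw [e2]
    calc _ ≤ 3481 / 18050 * L / (A.card * ε ^ 2) * (21 / 4 * A.card * ε ^ 2) := by gcongr
      _ = _ := by field_simp
  rw [e1] at h
  set P := μ.real {ω | ∃ i, ε * A.card / 4 < |∑ j ∈ A, ξ j ω * x j i|}
  have h1 : L * (59 / 4 * P) ≤ L * (1 + 3481 / 18050 * (21 / 4)) := by linarith
  have h2 := le_of_mul_le_mul_left h1 hL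
  linarith

end RobustLasso

/-! ### Assembly. -/

open RobustLasso

theorem theorem4p2
    {Ω : Type*} [MeasurableSpace Ω] (μ : Measure Ω) [IsProbabilityMeasure μ]
    (n D : ℕ)
    -- the fixed design, the true parameter, the noise and the observations
    (x : Fin n → EuclideanSpace ℝ (Fin D)) (lam₀ : EuclideanSpace ℝ (Fin D))
    (ξ Y : Fin n → Ω → ℝ) (σ M t ε : ℝ)
    (hσ : 0 ≤ σ)
    (hξ_meas : ∀ j, Measurable (ξ j))
    (hξ_indep : iIndepFun ξ μ)
    (hξ_memLp : ∀ j, MemLp (ξ j) 2 μ)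
    (hξ_mean : ∀ j, ∫ ω, ξ j ω ∂μ = 0)
    (hξ_var : ∀ j, variance (ξ j) μ ≤ σ ^ 2)
    (hY : ∀ j ω, Y j ω = inner ℝ lam₀ (x j) + ξ j ω)
    -- the number and the size of the blocks
    (ht : 0 < t) (k m : ℕ) (hk : k = ⌊3.5 * t⌋₊ + 1) (hm : m = n / k)
    (hkn : (k : ℝ) ≤ (n : ℝ) / 2)
    -- the assumptions on the design
    (hM : ∀ j i, |x j i| ≤ M)
    (kbar : ℝ≥0∞)
    (hkbar : kbar = ⨅ l : Fin k, RobustLasso.restrictedEigenvalue x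
      (RobustLasso.block n m l) (2 * RobustLasso.supportSize lam₀) 3)
    (hkbar_pos : 0 < kbar)
    -- the regularization parameter
    (hε_pos : 0 < ε)
    (hε : 95 * M * σ * √((t + 2 / 7) / n * Real.log (2 * D)) ≤ ε)
    -- the blockwise Lasso estimators and their geometric median
    (lamHat : Fin k → Ω → EuclideanSpace ℝ (Fin D))
    (hlamHat : ∀ (l : Fin k) (ω : Ω), RobustLasso.IsLasso x (fun j => Y j ω)
      (RobustLasso.block n m l) ε (lamHat l ω))
    (lamStar : Ω → EuclideanSpace ℝ (Fin D))
    (hlamStar : ∀ ω, RobustLasso.IsGeometricMedian (fun l => lamHat l ω) (lamStar ω)) :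
    ENNReal.ofReal (1 - Real.exp (-t)) ≤
      μ {ω | ENNReal.ofReal (‖lamStar ω - lam₀‖ ^ 2) ≤
        ENNReal.ofReal (83 * ε ^ 2 * RobustLasso.supportSize lam₀) / kbar ^ 4} := by
  classical
  rcases Nat.eq_zero_or_pos D with hD | hD
  · subst hD
    have h0 : ∀ ω, lamStar ω - lam₀ = 0 := fun ω => Subsingleton.elim _ _
    simp only [h0, norm_zero, zero_pow two_ne_zero, ENNReal.ofReal_zero, zero_le, Set.ofPred_true,
      measure_univ]
    exact ENNReal.ofReal_le_one.mpr (by linarith [Real.exp_pos (-t)])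
  have hk0 : 0 < k := by omega
  have h2k : 2 * k ≤ n := by
    have : (2 * k : ℝ) ≤ n := by linarith
    exact_mod_cast this
  have hn : 0 < n := by omega
  have hm2 : 2 ≤ m := by rw [hm, Nat.le_div_iff_mul_le hk0]; exact h2k
  have hkm : k * m ≤ n := by rw [hm]; exact Nat.mul_div_le n k
  have hnk : n ≤ k * (m + 1) := by rw [hm]; exact (Nat.lt_mul_div_succ n hk0).le
  have hkfloor : (k : ℝ) = ⌊3.5 * t⌋₊ + 1 := by rw [hk]; push_cast; rfl
  have hkt : (k : ℝ) ≤ 7 / 2 * t + 1 := by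
    have := Nat.floor_le (a := 3.5 * t) (by positivity)
    rw [hkfloor]; linarith
  have htk : 7 / 2 * t ≤ k := by
    have := Nat.lt_floor_add_one (3.5 * t)
    rw [hkfloor]; linarith
  have hM0 : 0 ≤ M := (abs_nonneg _).trans (hM ⟨0, hn⟩ ⟨0, hD⟩)
  have hcard : ∀ l : Fin k, (block n m l).card = m := fun l =>
    card_block ((Nat.mul_le_mul_right m l.2).trans hkm)
  have hL : 0 ≤ Real.log (2 * D) := by
    refine Real.log_nonneg ?_
    have : (1 : ℝ) ≤ D := by exact_mod_cast hD
    linarith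
  have hnoise := noise_level_le ht hkt hm2 hn hnk hM0 hσ hL hε
  have hrestrict : ∀ (l : Fin k) (ω : Ω) (i : Fin D),
      ∑ j ∈ block n m l, (if j ∈ block n m l then ξ j ω else 0) * x j i =
        ∑ j ∈ block n m l, ξ j ω * x j i := fun l ω i =>
    Finset.sum_congr rfl fun j hj => by rw [if_pos hj]
  set bad : Fin k → (Fin n → ℝ) → Prop := fun l y =>
    ∃ i, ε * (block n m l).card / 4 < |∑ j ∈ block n m l, y j * x j i| with hbad
  have hbad_iff : ∀ l ω, bad l (fun j => if j ∈ block n m l then ξ j ω else 0) ↔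
      ∃ i, ε * (block n m l).card / 4 < |∑ j ∈ block n m l, ξ j ω * x j i| := by
    intro l ω
    simp only [hbad, hrestrict]
  have hprob := measureReal_card_gt_le (b := bad) (t := t) hξ_meas hξ_indep
    (G := fun l => block n m l)
    (fun l l' h => disjoint_block (Fin.val_injective.ne h))
    (fun l => by
      simp only [hbad, Set.ofPred_exists]
      exact MeasurableSet.iUnion fun i => measurableSet_lt measurable_const (by fun_prop))
    (fun l => by
      simp only [hbad_iff]
      refine measureReal_noise_gt_le hD hξ_meas hξ_indep hξ_memLp hξ_mean hξ_var hM _ ?_ hε_pos ?_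
      · rw [hcard]; omega
      · rw [hcard]; exact hnoise)
    htk
  set E := {ω | (23 / 50 : ℝ) * k ≤ ((Finset.univ.filter fun l : Fin k =>
    bad l (fun j => if j ∈ block n m l then ξ j ω else 0)).card : ℝ)}
  have hEc : ENNReal.ofReal (1 - Real.exp (-t)) ≤ μ Eᶜ := by
    rw [ENNReal.ofReal_sub _ (Real.exp_pos _).le, ENNReal.ofReal_one, tsub_le_iff_right]
    have h1 : μ E ≤ ENNReal.ofReal (Real.exp (-t)) :=
      (ENNReal.le_ofReal_iff_toReal_le (measure_ne_top _ _) (Real.exp_pos _).le).mpr hprob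
    calc (1 : ℝ≥0∞) = μ Set.univ := measure_univ.symm
      _ = μ (Eᶜ ∪ E) := by rw [Set.compl_union_self]
      _ ≤ μ Eᶜ + μ E := measure_union_le _ _
      _ ≤ _ := by gcongr
  -- The event `Eᶜ` involves only the noise, so the estimators need not be measurable.
  refine hEc.trans (measure_mono fun ω hω => ?_)
  simp only [E, Set.mem_compl_iff, Set.mem_ofPred_eq, not_le] at hω
  set s := supportSize lam₀
  set R := 45 / 2 * ε ^ 2 * s / kbar.toReal ^ 4 with hR
  have hR0 : 0 ≤ R := by positivity
  have hmed := (hlamStar ω).mul_norm_sub_sq_le (c := lam₀) (r := √R) hk0 (Real.sqrt_nonneg _) _ hω.le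
    (by norm_num) fun l hl => by
      refine Real.le_sqrt_of_sq_le ?_
      refine (hlamHat l ω).norm_sub_sq_le (ξ := fun j => ξ j ω) (fun j => hY j ω) ?_ hε_pos ?_
        (hkbar ▸ iInf_le _ l) hkbar_pos
      · rw [hcard]; omega
      · simpa [hbad_iff] using hl
  rw [Real.sq_sqrt hR0] at hmed
  have hfinal : ‖lamStar ω - lam₀‖ ^ 2 ≤ 83 * ε ^ 2 * s / kbar.toReal ^ 4 := by
    have e : 83 * ε ^ 2 * s / kbar.toReal ^ 4 = 83 * (2 / 45) * R := by rw [hR]; ring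
    rw [e]
    linarith
  -- For `kbar = ⊤`, `toReal` is `0` and the real quotient is `0` by convention, which agrees with
  -- division by `⊤`.
  rcases eq_or_ne kbar ⊤ with htop | htop
  · simp only [htop, ENNReal.toReal_top, zero_pow four_ne_zero, div_zero] at hfinal
    simp only [Set.mem_ofPred_eq, ENNReal.ofReal_of_nonpos hfinal, zero_le]
  · have hκ : 0 < kbar.toReal := ENNReal.toReal_pos hkbar_pos.ne' htop
    rw [Set.mem_ofPred_eq, ← ENNReal.ofReal_toReal htop, ← ENNReal.ofReal_pow hκ.le,
      ← ENNReal.ofReal_div_of_pos (by positivity)]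
    exact ENNReal.ofReal_le_ofReal hfinal
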